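/- All systems are finite-dimensional Hilbert spaces of dimension at least one, $|B|$ denotes the dimension of $B$, and a quantum channel is a completely positive, trace preserving linear map. For a state $\rho$ let $H(\rho)=-\operatorname{Tr}\{\rho\log_2\rho\}$, and write $H(B|R)_\omega=H(RB)_\omega-H(R)_\omega$ for the conditional entropy of a bipartite state. For states $\rho,\sigma$ let $D(\rho\Vert\sigma)=\operatorname{Tr}\{\rho[\log_2\rho-\log_2\sigma]\}$ if $\operatorname{supp}\rho\subseteq\operatorname{supp}\sigma$, and $D(\rho\Vert\sigma)=+\infty$ otherwise. Let $\mathcal N_{A\to B}$ be a quantum channel. Define its entropy by $$H(\mathcal N)=\log_2|B|-\sup_{\rho_{RA}}D\big((\mathrm{id}_R\otimes\mathcal N)(\rho_{RA})\,\Vert\,(\mathrm{id}_R\otimes\mathcal R)(\rho_{RA})\big),$$ where $\mathcal R_{A\to B}(X)=\operatorname{Tr}\{X\}\,I_B/|B|$ is the completely randomizing channel and the supremum is over all states $\rho_{RA}$ with a reference system $R$ of arbitrary finite dimension. Then $$H(\mathcal N)=\inf_{\rho_{RA}}H(B|R)_{(\mathrm{id}_R\otimes\mathcal N)(\rho_{RA})}=\inf_{\psi_{RA}}H(B|R)_{(\mathrm{id}_R\otimes\mathcal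 N)(\psi_{RA})},$$ where the first infimum (the completely bounded entropy of $\mathcal N$) is over all states $\rho_{RA}$ with $R$ of arbitrary finite dimension and the second is over the pure states $\psi_{RA}$ with $R\cong A$. Moreover, let $V:A\to B\otimes E$ be any isometry with $\mathcal N(X)=\operatorname{Tr}_E\{VXV^\dagger\}$ for all $X$, and put $\tau_{BE}=V\rho_AV^\dagger$ for a state $\rho_A$. Then $$H(\mathcal N)=\inf_{\rho_A}\big[H(E)_\tau-H(A)_\rho\big]=-\sup_{\rho_A}H(B|E)_\tau,$$ where the infimum (the entropy gain of the complementary channel $X\mapsto\operatorname{Tr}_B\{VXV^\dagger\}$) and the supremum are over all states $\rho_A$ of $A$. Consequently $H(\mathcal N)$ is finite and $|H(\mathcal N)|\le\log_2|B|$. -/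

import Mathlib

/-!
Finite-dimensional quantum systems. A system `A` is given by a finite index type of an orthonormal
basis of its Hilbert space, its operators are the complex matrices indexed by `A`, its dimension
`|A|` is `Fintype.card A`, and the joint system of `R` and `A` is indexed by `R × A`.
Logarithms are to base two. Suprema and infima are taken in the complete lattice `EReal`.
-/

open scoped ComplexOrder

noncomputable section

namespace QChannel

/-- A (mixed) quantum state: a positive semi-definite operator of trace one. -/
def IsState {A : Type*} [Fintype A] (ρ : Matrix A A ℂ) : Prop :=
  ρ.PosSemidef ∧ ρ.trace = 1

/-- A pure state: a state of the form `|ψ⟩⟨ψ|`. -/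
def IsPureState {A : Type*} [Fintype A] (ρ : Matrix A A ℂ) : Prop :=
  IsState ρ ∧ ∃ ψ : A → ℂ, ρ = Matrix.vecMulVec ψ (star ψ)

/-- The logarithm to base two of a Hermitian matrix, by the functional calculus; as
`Real.logb 2 0 = 0`, it is taken on the support of the matrix. -/
def log2 {A : Type*} [Fintype A] [DecidableEq A] (ρ : Matrix A A ℂ) : Matrix A A ℂ :=
  cfc (Real.logb 2) ρ

/-- The von Neumann entropy `H(ρ) = -Tr{ρ log₂ ρ}`. -/
def entropy {A : Type*} [Fintype A] [DecidableEq A] (ρ : Matrix A A ℂ) : ℝ :=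
  -(ρ * log2 ρ).trace.re

/-- The support of a Hermitian matrix, i.e. the orthogonal complement of its kernel, which is its
range. -/
def supp {A : Type*} [Fintype A] (ρ : Matrix A A ℂ) : Submodule ℂ (A → ℂ) :=
  LinearMap.range ρ.mulVecLin

open Classical in
/-- The quantum relative entropy `D(ρ‖σ)`, equal to `Tr{ρ [log₂ ρ - log₂ σ]}` if
`supp ρ ⊆ supp σ` and to `+∞` otherwise. -/
def relEntropy {A : Type*} [Fintype A] [DecidableEq A] (ρ σ : Matrix A A ℂ) : EReal :=
  if supp ρ ≤ supp σ then (((ρ * (log2 ρ - log2 σ)).trace.re : ℝ) : EReal) else ⊤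

/-- The partial trace over the first tensor factor. -/
def traceFst (R A : Type*) [Fintype R] :
    Matrix (R × A) (R × A) ℂ →ₗ[ℂ] Matrix A A ℂ where
  toFun X := Matrix.of fun a a' => ∑ r, X (r, a) (r, a')
  map_add' X Y := by ext a a'; simp [Finset.sum_add_distrib]
  map_smul' c X := by ext a a'; simp [Finset.mul_sum]

/-- The partial trace over the second tensor factor. -/
def traceSnd (R A : Type*) [Fintype A] :
    Matrix (R × A) (R × A) ℂ →ₗ[ℂ] Matrix R R ℂ where
  toFun X := Matrix.of fun r r' => ∑ a, X (r, a) (r', a)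
  map_add' X Y := by ext a a'; simp [Finset.sum_add_distrib]
  map_smul' c X := by ext a a'; simp [Finset.mul_sum]

/-- For `ω` on the joint system of `R` and `B`, the conditional entropy
`H(B|R)_ω = H(RB)_ω - H(R)_ω` of the second system given the first. -/
def condEntropyGivenFst {R B : Type*} [Fintype R] [DecidableEq R] [Fintype B] [DecidableEq B]
    (ω : Matrix (R × B) (R × B) ℂ) : ℝ :=
  entropy ω - entropy (traceSnd R B ω)

/-- For `τ` on the joint system of `B` and `E`, the conditional entropy
`H(B|E)_τ = H(BE)_τ - H(E)_τ` of the first system given the second. -/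
def condEntropyGivenSnd {B E : Type*} [Fintype B] [DecidableEq B] [Fintype E] [DecidableEq E]
    (τ : Matrix (B × E) (B × E) ℂ) : ℝ :=
  entropy τ - entropy (traceFst B E τ)

/-- The action of `id_R ⊗ N` on operators of the joint system of `R` and `A`: the map `N` is
applied to each block of the block matrix. -/
def idTensor {A B : Type*} (R : Type*) (N : Matrix A A ℂ →ₗ[ℂ] Matrix B B ℂ)
    (X : Matrix (R × A) (R × A) ℂ) : Matrix (R × B) (R × B) ℂ :=
  Matrix.of fun p q => N (Matrix.of fun a a' => X (p.1, a) (q.1, a')) p.2 q.2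

/-- A quantum channel: a completely positive, trace preserving linear map. -/
structure IsChannel {A B : Type*} [Fintype A] [Fintype B]
    (N : Matrix A A ℂ →ₗ[ℂ] Matrix B B ℂ) : Prop where
  completely_positive : ∀ (n : ℕ) (X : Matrix (Fin n × A) (Fin n × A) ℂ),
    X.PosSemidef → (idTensor (Fin n) N X).PosSemidef
  trace_preserving : ∀ X : Matrix A A ℂ, (N X).trace = X.trace

/-- The completely randomizing channel `X ↦ Tr{X} I / |B|`. -/
def randomizing (A B : Type*) [Fintype A] [Fintype B] [DecidableEq B] :
    Matrix A A ℂ →ₗ[ℂ] Matrix B B ℂ :=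
  (Matrix.traceLinearMap A ℂ ℂ).smulRight ((Fintype.card B : ℂ)⁻¹ • (1 : Matrix B B ℂ))

/-- The relative entropy of channels `D(N‖M)`: the supremum of `D(N(ρ_RA)‖M(ρ_RA))` over all
states `ρ_RA`, where the reference system `R` has arbitrary size. -/
def channelRelEntropy {A B : Type*} [Fintype A] [DecidableEq A] [Fintype B] [DecidableEq B]
    (N M : Matrix A A ℂ →ₗ[ℂ] Matrix B B ℂ) : EReal :=
  ⨆ (n : ℕ) (ρ : {ρ : Matrix (Fin n × A) (Fin n × A) ℂ // IsState ρ}),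
    relEntropy (idTensor (Fin n) N ρ.1) (idTensor (Fin n) M ρ.1)

/-- The entropy of a channel, `H(N) = log₂|B| - D(N‖R)` for the completely randomizing channel
`R`. -/
def channelEntropy {A B : Type*} [Fintype A] [DecidableEq A] [Fintype B] [DecidableEq B]
    (N : Matrix A A ℂ →ₗ[ℂ] Matrix B B ℂ) : EReal :=
  ((Real.logb 2 (Fintype.card B) : ℝ) : EReal) - channelRelEntropy N (randomizing A B)

/-- The completely bounded entropy: the infimum of `H(B|R)` of `N(ρ_RA)` over all states `ρ_RA`,
where the reference system `R` has arbitrary size. -/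
def cbEntropy {A B : Type*} [Fintype A] [DecidableEq A] [Fintype B] [DecidableEq B]
    (N : Matrix A A ℂ →ₗ[ℂ] Matrix B B ℂ) : EReal :=
  ⨅ (n : ℕ) (ρ : {ρ : Matrix (Fin n × A) (Fin n × A) ℂ // IsState ρ}),
    ((condEntropyGivenFst (idTensor (Fin n) N ρ.1) : ℝ) : EReal)

/-- The infimum of `H(B|R)` of `N(ψ_RA)` over the pure states `ψ_RA` whose reference system `R` is
a copy of the input system. -/
def cbEntropyPure {A B : Type*} [Fintype A] [DecidableEq A] [Fintype B] [DecidableEq B]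
    (N : Matrix A A ℂ →ₗ[ℂ] Matrix B B ℂ) : EReal :=
  ⨅ ψ : {ψ : Matrix (A × A) (A × A) ℂ // IsPureState ψ},
    ((condEntropyGivenFst (idTensor A N ψ.1) : ℝ) : EReal)

/-- The conjugation `X ↦ V X Vᴴ`; it is an isometric channel if `Vᴴ V = 1`. -/
def conjMap {A C : Type*} [Fintype A] (V : Matrix C A ℂ) :
    Matrix A A ℂ →ₗ[ℂ] Matrix C C ℂ where
  toFun X := V * X * V.conjTranspose
  map_add' X Y := by rw [Matrix.mul_add, Matrix.add_mul]
  map_smul' c X := by simp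

/-- The isometric channel `X ↦ V X Vᴴ` from `A` to the joint system of `B` and `E` extends `N`:
`V` is an isometry and `N = Tr_E ∘ (V · Vᴴ)`. -/
structure IsIsometricExtension {A B E : Type*} [Fintype A] [DecidableEq A] [Fintype B]
    [Fintype E] (N : Matrix A A ℂ →ₗ[ℂ] Matrix B B ℂ) (V : Matrix (B × E) A ℂ) : Prop where
  isometry : V.conjTranspose * V = 1
  extends_channel : N = traceSnd B E ∘ₗ conjMap V

/-- The complementary channel `Tr_B ∘ (V · Vᴴ)` determined by an isometric extension. -/
def complementary {A B E : Type*} [Fintype A] [Fintype B]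
    (V : Matrix (B × E) A ℂ) : Matrix A A ℂ →ₗ[ℂ] Matrix E E ℂ :=
  traceFst B E ∘ₗ conjMap V

/-- The entropy gain `inf_ρ [H(M(ρ)) - H(ρ)]` of a channel `M`. -/
def entropyGain {A E : Type*} [Fintype A] [DecidableEq A] [Fintype E] [DecidableEq E]
    (M : Matrix A A ℂ →ₗ[ℂ] Matrix E E ℂ) : EReal :=
  ⨅ ρ : {ρ : Matrix A A ℂ // IsState ρ}, ((entropy (M ρ.1) - entropy ρ.1 : ℝ) : EReal)

/-- The maximum over input states `ρ` of the output entropy `H(B|E)` of `V ρ Vᴴ` conditioned on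
the environment. -/
def maxEnvCondEntropy {A B E : Type*} [Fintype A] [Fintype B] [DecidableEq B]
    [Fintype E] [DecidableEq E] (V : Matrix (B × E) A ℂ) : EReal :=
  ⨆ ρ : {ρ : Matrix A A ℂ // IsState ρ}, ((condEntropyGivenSnd (conjMap V ρ.1) : ℝ) : EReal)

end QChannel

end

noncomputable section

namespace QChannel

set_option linter.unusedSectionVars false

open Matrix Polynomial Kronecker

variable {A B C R E : Type*} [Fintype A] [DecidableEq A] [Fintype B] [DecidableEq B]
  [Fintype C] [DecidableEq C] [Fintype R] [DecidableEq R] [Fintype E] [DecidableEq E]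

/-! The randomizing channel sends `ρ_RA` to `ω_R ⊗ 1/|B|`, where `ω` is the output of `N`, because
trace preservation leaves the marginal on `R` untouched. As `D(ω‖ω_R ⊗ 1/|B|) = log₂|B| - H(B|R)_ω`,
the channel entropy equals the completely bounded entropy term by term
(`channelEntropy_eq_cbEntropy`).

For a pure input, an isometric extension makes the state on `RBE` pure, so `H(RB) = H(E)` and `H(R)
= H(A)`. Hence `H(B|R) = H(E) - H(A)` depends only on `ρ_A`, and every `ρ_A` has a purification with
`R` a copy of `A`: the pure infimum is the entropy gain. Since `H(BE) = H(A)`, it is also `-sup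
H(B|E)`.

Mixed inputs give nothing smaller, because `H(B|R)` is concave (`sum_condEntropyGivenFst_le`). This
rests on joint convexity of relative entropy, the one deep ingredient. It is proved by writing the
relative entropy through resolvent forms of the relative modular operator, each a maximum of
functionals additive in `(ρ, σ)`, and then integrating.

The bounds are Klein's inequality against `ω_R ⊗ 1/|B|`, applied to `H(B|R)` and to `H(B|E)`. -/

/-! ### The functional calculus of Hermitian matrices -/

/-- The matrix of overlaps `⟨eᵢ|fⱼ⟩` of the eigenbases of two Hermitian matrices. -/
def overlap {ρ σ : Matrix A A ℂ} (hρ : ρ.IsHermitian) (hσ : σ.IsHermitian) : Matrix A A ℂ :=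
  (hρ.eigenvectorUnitary : Matrix A A ℂ)ᴴ * (hσ.eigenvectorUnitary : Matrix A A ℂ)

lemma eigenvectorUnitary_conjTranspose_mul {ρ : Matrix A A ℂ} (hρ : ρ.IsHermitian) :
    (hρ.eigenvectorUnitary : Matrix A A ℂ)ᴴ * (hρ.eigenvectorUnitary : Matrix A A ℂ) = 1 :=
  Unitary.coe_star_mul_self hρ.eigenvectorUnitary

lemma eigenvectorUnitary_mul_conjTranspose {ρ : Matrix A A ℂ} (hρ : ρ.IsHermitian) :
    (hρ.eigenvectorUnitary : Matrix A A ℂ) * (hρ.eigenvectorUnitary : Matrix A A ℂ)ᴴ = 1 :=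
  Unitary.coe_mul_star_self hρ.eigenvectorUnitary

lemma cfc_eq_conj_diagonal {ρ : Matrix A A ℂ} (hρ : ρ.IsHermitian) (f : ℝ → ℝ) :
    cfc f ρ = (hρ.eigenvectorUnitary : Matrix A A ℂ) *
      diagonal (fun i => (f (hρ.eigenvalues i) : ℂ)) *
      (hρ.eigenvectorUnitary : Matrix A A ℂ)ᴴ := by
  rw [hρ.cfc_eq, Matrix.IsHermitian.cfc, Unitary.conjStarAlgAut_apply]
  rfl

lemma eq_conj_diagonal {ρ : Matrix A A ℂ} (hρ : ρ.IsHermitian) :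
    ρ = (hρ.eigenvectorUnitary : Matrix A A ℂ) *
      diagonal (fun i => (hρ.eigenvalues i : ℂ)) *
      (hρ.eigenvectorUnitary : Matrix A A ℂ)ᴴ := by
  have h := cfc_eq_conj_diagonal hρ (fun x => x)
  exact (cfc_id' ℝ ρ hρ).symm.trans h

lemma trace_diagonal_mul_mul_diagonal_mul (p q : A → ℝ) (G : Matrix A A ℂ) :
    (diagonal (fun i => (p i : ℂ)) * G * diagonal (fun i => (q i : ℂ)) * Gᴴ).trace.re =
      ∑ i, ∑ j, Complex.normSq (G i j) * p i * q j := by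
  rw [Matrix.trace, Complex.re_sum]
  refine Finset.sum_congr rfl fun i _ => ?_
  rw [diag_apply, Matrix.mul_apply, Complex.re_sum]
  refine Finset.sum_congr rfl fun j _ => ?_
  rw [mul_diagonal, diagonal_mul, conjTranspose_apply]
  have : (p i : ℂ) * G i j * (q j : ℂ) * star (G i j) =
      ((Complex.normSq (G i j) * p i * q j : ℝ) : ℂ) := by
    push_cast
    rw [← Complex.mul_conj, Complex.star_def]
    ring
  rw [this, Complex.ofReal_re]

/-- Expansion in the two eigenbases. It turns noncommuting traces into classical double sums with
weights `|⟨eᵢ|fⱼ⟩|² pᵢ`. -/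
lemma trace_mul_cfc {ρ σ : Matrix A A ℂ} (hρ : ρ.IsHermitian) (hσ : σ.IsHermitian)
    (f : ℝ → ℝ) : (ρ * cfc f σ).trace.re =
      ∑ i, ∑ j, Complex.normSq (overlap hρ hσ i j) * hρ.eigenvalues i * f (hσ.eigenvalues j) := by
  rw [← trace_diagonal_mul_mul_diagonal_mul _ (fun j => f (hσ.eigenvalues j)), overlap,
    cfc_eq_conj_diagonal hσ, conjTranspose_mul, conjTranspose_conjTranspose]
  conv_lhs => rw [eq_conj_diagonal hρ]
  simp only [Matrix.mul_assoc]
  rw [trace_mul_comm]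
  simp only [Matrix.mul_assoc]

lemma overlap_mul_conjTranspose {ρ σ : Matrix A A ℂ} (hρ : ρ.IsHermitian) (hσ : σ.IsHermitian) :
    overlap hρ hσ * (overlap hρ hσ)ᴴ = 1 := by
  rw [overlap, conjTranspose_mul, conjTranspose_conjTranspose, mul_assoc,
    ← mul_assoc (hσ.eigenvectorUnitary : Matrix A A ℂ), eigenvectorUnitary_mul_conjTranspose,
    one_mul, eigenvectorUnitary_conjTranspose_mul]

lemma overlap_self {ρ : Matrix A A ℂ} (hρ : ρ.IsHermitian) : overlap hρ hρ = 1 :=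
  eigenvectorUnitary_conjTranspose_mul hρ

lemma sum_normSq_overlap {ρ σ : Matrix A A ℂ} (hρ : ρ.IsHermitian) (hσ : σ.IsHermitian) :
    ∑ i, ∑ j, Complex.normSq (overlap hρ hσ i j) * hρ.eigenvalues i = ρ.trace.re := by
  have h := trace_mul_cfc hρ hσ (fun _ => 1)
  have h1 : cfc (fun _ : ℝ => (1 : ℝ)) σ = 1 := cfc_const_one ℝ σ hσ
  rw [h1, Matrix.mul_one] at h
  simpa using h.symm

lemma sum_normSq_overlap' {ρ σ : Matrix A A ℂ} (hρ : ρ.IsHermitian) (hσ : σ.IsHermitian) :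
    ∑ i, ∑ j, Complex.normSq (overlap hρ hσ i j) * hσ.eigenvalues j = σ.trace.re := by
  have h := trace_diagonal_mul_mul_diagonal_mul (fun _ => 1) hσ.eigenvalues (overlap hρ hσ)
  simp only [mul_one] at h
  rw [← h]
  congr 1
  conv_rhs => rw [eq_conj_diagonal hσ]
  have h2 : (overlap hρ hσ)ᴴ * overlap hρ hσ = 1 :=
    mul_eq_one_comm.mp (overlap_mul_conjTranspose hρ hσ)
  have h1 : diagonal (fun _ : A => ((1 : ℝ) : ℂ)) = 1 := by simp
  rw [h1, one_mul, trace_mul_comm, ← mul_assoc, h2, one_mul, trace_mul_comm, ← mul_assoc,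
    eigenvectorUnitary_conjTranspose_mul, one_mul]

lemma trace_mul_cfc_self {ρ : Matrix A A ℂ} (hρ : ρ.IsHermitian) (f : ℝ → ℝ) :
    (ρ * cfc f ρ).trace.re = ∑ i, hρ.eigenvalues i * f (hρ.eigenvalues i) := by
  rw [trace_mul_cfc hρ hρ]
  refine Finset.sum_congr rfl fun i _ => ?_
  rw [Finset.sum_eq_single i]
  · simp [overlap_self]
  · intro j _ hj
    simp [overlap_self, Matrix.one_apply_ne hj.symm]
  · simp

/-- Lagrange interpolation on the union of the two finite spectra. Having one polynomial for both
matrices lets algebraic identities pass to the functional calculus. -/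
lemma exists_cfc_eq_aeval {ρ : Matrix A A ℂ} {σ : Matrix B B ℂ} (hρ : ρ.IsHermitian)
    (hσ : σ.IsHermitian) (f : ℝ → ℝ) :
    ∃ p : ℝ[X], cfc f ρ = aeval ρ p ∧ cfc f σ = aeval σ p := by
  classical
  let S := ρ.finite_real_spectrum.toFinset ∪ σ.finite_real_spectrum.toFinset
  refine ⟨Lagrange.interpolate S id f, ?_, ?_⟩
  · rw [← cfc_polynomial _ ρ hρ]
    refine cfc_congr fun x hx => ?_
    exact (Lagrange.eval_interpolate_at_node (s := S) (v := id) (i := x) f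
      Function.injective_id.injOn (by simp [S, hx])).symm
  · rw [← cfc_polynomial _ σ hσ]
    refine cfc_congr fun x hx => ?_
    exact (Lagrange.eval_interpolate_at_node (s := S) (v := id) (i := x) f
      Function.injective_id.injOn (by simp [S, hx])).symm

/-- The functional calculus commutes with unital homomorphisms. -/
lemma cfc_algHom (φ : Matrix A A ℂ →ₐ[ℝ] Matrix B B ℂ) {ρ : Matrix A A ℂ} (hρ : ρ.IsHermitian)
    (hφ : (φ ρ).IsHermitian) (f : ℝ → ℝ) : cfc f (φ ρ) = φ (cfc f ρ) := by
  obtain ⟨p, h₁, h₂⟩ := exists_cfc_eq_aeval hρ hφ f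
  rw [h₁, h₂, aeval_algHom_apply]

lemma pow_mul_intertwine {X : Matrix A A ℂ} {Y : Matrix B B ℂ} {M : Matrix A B ℂ}
    (h : X * M = M * Y) (n : ℕ) : X ^ n * M = M * Y ^ n := by
  induction n with
  | zero => simp
  | succ n ih => rw [pow_succ, Matrix.mul_assoc, h, ← Matrix.mul_assoc, ih, pow_succ,
      Matrix.mul_assoc]

lemma aeval_mul_intertwine {X : Matrix A A ℂ} {Y : Matrix B B ℂ} {M : Matrix A B ℂ}
    (h : X * M = M * Y) (p : ℝ[X]) : aeval X p * M = M * aeval Y p := by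
  induction p using Polynomial.induction_on' with
  | add p q hp hq => rw [map_add, map_add, Matrix.add_mul, Matrix.mul_add, hp, hq]
  | monomial n a =>
    rw [aeval_monomial, aeval_monomial, ← Algebra.smul_def, ← Algebra.smul_def, Matrix.smul_mul,
      pow_mul_intertwine h, Matrix.mul_smul]

/-- The intertwining `p(MMᴴ) M = M p(MᴴM)` and cyclicity of the trace avoid any matching of
eigenvalues, also for rectangular `M`. This is why both marginals of a pure state have equal
entropy. -/
lemma entropy_mul_conjTranspose (M : Matrix A B ℂ) : entropy (M * Mᴴ) = entropy (Mᴴ * M) := by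
  obtain ⟨p, h₁, h₂⟩ := exists_cfc_eq_aeval (isHermitian_mul_conjTranspose_self M)
    (isHermitian_conjTranspose_mul_self M) (Real.logb 2)
  have h : aeval (M * Mᴴ) p * M = M * aeval (Mᴴ * M) p :=
    aeval_mul_intertwine (Matrix.mul_assoc M Mᴴ M) p
  rw [entropy, entropy, log2, log2, h₁, h₂, trace_mul_comm, ← Matrix.mul_assoc, h,
    trace_mul_comm, Matrix.mul_assoc, ← Matrix.mul_assoc]

lemma aeval_transpose (ρ : Matrix A A ℂ) (p : ℝ[X]) : aeval ρᵀ p = (aeval ρ p)ᵀ := by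
  induction p using Polynomial.induction_on' with
  | add p q hp hq => rw [map_add, map_add, hp, hq, transpose_add]
  | monomial n a =>
    rw [aeval_monomial, aeval_monomial, ← Algebra.smul_def, ← Algebra.smul_def, transpose_smul,
      transpose_pow]

lemma entropy_transpose {ρ : Matrix A A ℂ} (hρ : ρ.IsHermitian) : entropy ρᵀ = entropy ρ := by
  obtain ⟨p, h₁, h₂⟩ := exists_cfc_eq_aeval hρ hρ.transpose (Real.logb 2)
  rw [entropy, entropy, log2, log2, h₁, h₂, aeval_transpose, ← transpose_mul, trace_transpose,
    trace_mul_comm]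

open scoped MatrixOrder in
/-- A positive semi-definite matrix has a square factorization. -/
lemma exists_eq_conjTranspose_mul {ρ : Matrix A A ℂ} (hρ : ρ.PosSemidef) :
    ∃ M : Matrix A A ℂ, ρ = Mᴴ * M :=
  CStarAlgebra.nonneg_iff_eq_star_mul_self.mp hρ.nonneg

/-! ### Joint convexity of the relative entropy -/

lemma sum_row_normSq_overlap {ρ σ : Matrix A A ℂ} (hρ : ρ.IsHermitian) (hσ : σ.IsHermitian)
    (i : A) : ∑ j, Complex.normSq (overlap hρ hσ i j) = 1 := by
  have h := congrFun (congrFun (overlap_mul_conjTranspose hρ hσ) i) i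
  rw [Matrix.mul_apply, one_apply_eq] at h
  have h2 := congrArg Complex.re h
  rw [Complex.re_sum, Complex.one_re] at h2
  rw [← h2]
  refine Finset.sum_congr rfl fun j _ => ?_
  rw [conjTranspose_apply, Complex.star_def, Complex.mul_conj, Complex.ofReal_re]

lemma trace_mul_log2_sub_log2 {ρ σ : Matrix A A ℂ} (hρ : ρ.IsHermitian) (hσ : σ.IsHermitian) :
    (ρ * (log2 ρ - log2 σ)).trace.re =
      (∑ i, ∑ j, Complex.normSq (overlap hρ hσ i j) * hρ.eigenvalues i *
        (Real.log (hρ.eigenvalues i) - Real.log (hσ.eigenvalues j))) / Real.log 2 := by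
  rw [Matrix.mul_sub, trace_sub, Complex.sub_re, log2, log2, trace_mul_cfc_self hρ,
    trace_mul_cfc hρ hσ, ← Finset.sum_sub_distrib, Finset.sum_div]
  refine Finset.sum_congr rfl fun i _ => ?_
  rw [← one_mul (hρ.eigenvalues i * _), ← sum_row_normSq_overlap hρ hσ i, Finset.sum_mul,
    ← Finset.sum_sub_distrib, Finset.sum_div]
  refine Finset.sum_congr rfl fun j _ => ?_
  rw [Real.logb, Real.logb]
  ring

lemma mul_eigenvectorUnitary {ρ : Matrix A A ℂ} (hρ : ρ.IsHermitian) :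
    ρ * (hρ.eigenvectorUnitary : Matrix A A ℂ) = (hρ.eigenvectorUnitary : Matrix A A ℂ) *
      diagonal (fun i => (hρ.eigenvalues i : ℂ)) := by
  have h := congrArg (· * (hρ.eigenvectorUnitary : Matrix A A ℂ)) (eq_conj_diagonal hρ)
  simpa only [Matrix.mul_assoc, eigenvectorUnitary_conjTranspose_mul, Matrix.mul_one] using h

lemma conjTranspose_eigenvectorUnitary_mul {ρ : Matrix A A ℂ} (hρ : ρ.IsHermitian) :
    (hρ.eigenvectorUnitary : Matrix A A ℂ)ᴴ * ρ = diagonal (fun i => (hρ.eigenvalues i : ℂ)) *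
      (hρ.eigenvectorUnitary : Matrix A A ℂ)ᴴ := by
  have h := congrArg ((hρ.eigenvectorUnitary : Matrix A A ℂ)ᴴ * ·) (eq_conj_diagonal hρ)
  simpa only [← Matrix.mul_assoc, eigenvectorUnitary_conjTranspose_mul, Matrix.one_mul] using h

/-- A null eigenvector `fⱼ` of `σ` is killed by `ρ`, so `pᵢ⟨eᵢ|fⱼ⟩ = 0`. Thus the default value `log
0 = 0` never carries weight. -/
lemma overlap_eq_zero_of_ker {ρ σ : Matrix A A ℂ} (hρ : ρ.IsHermitian) (hσ : σ.IsHermitian)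
    (h : ∀ v, σ *ᵥ v = 0 → ρ *ᵥ v = 0) (i j : A) (hj : hσ.eigenvalues j = 0) :
    Complex.normSq (overlap hρ hσ i j) * hρ.eigenvalues i = 0 := by
  have h1 : σ *ᵥ ((hσ.eigenvectorUnitary : Matrix A A ℂ) *ᵥ Pi.single j 1) = 0 := by
    rw [mulVec_mulVec, mul_eigenvectorUnitary, ← mulVec_mulVec, mulVec_single_one]
    have : (diagonal fun i => (hσ.eigenvalues i : ℂ)).col j = 0 := by
      ext k
      rcases eq_or_ne k j with rfl | hk
      · simp [hj]
      · simp [hk]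
    rw [this, mulVec_zero]
  have h2 := congrArg (fun v => (hρ.eigenvectorUnitary : Matrix A A ℂ)ᴴ *ᵥ v) (h _ h1)
  simp only [mulVec_zero] at h2
  rw [mulVec_mulVec, mulVec_mulVec, conjTranspose_eigenvectorUnitary_mul, Matrix.mul_assoc,
    mulVec_single_one] at h2
  have h3 : (hρ.eigenvalues i : ℂ) * overlap hρ hσ i j = 0 := by
    have := congrFun h2 i
    rwa [col_apply, diagonal_mul] at this
  rcases mul_eq_zero.mp h3 with h4 | h4
  · rw [Complex.ofReal_eq_zero.mp h4, mul_zero]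
  · rw [h4, map_zero, zero_mul]

/-- The quadratic functional whose maximum over `X` is `resolventForm`. -/
def quadForm (t : ℝ) (ρ σ X : Matrix A A ℂ) : ℝ :=
  2 * (ρ * X).trace.re - t * (Xᴴ * ρ * X).trace.re - (X * σ * Xᴴ).trace.re

/-- The quadratic form `⟨ρ, (L_σ + t R_ρ)⁻¹ ρ⟩` of the resolvent of the relative modular operator,
expanded in the eigenbases of `ρ` and `σ`. -/
def resolventForm {ρ σ : Matrix A A ℂ} (hρ : ρ.IsHermitian) (hσ : σ.IsHermitian) (t : ℝ) : ℝ :=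
  ∑ i, ∑ j, Complex.normSq (overlap hρ hσ i j) * hρ.eigenvalues i * hρ.eigenvalues i /
    (t * hρ.eigenvalues i + hσ.eigenvalues j)

/-- In the coordinates `Y = Uᴴ X W` the functional decouples into one scalar quadratic for each
entry, which can be maximized separately. -/
lemma quadForm_conj {ρ σ : Matrix A A ℂ} (hρ : ρ.IsHermitian) (hσ : σ.IsHermitian) (t : ℝ)
    (Y : Matrix A A ℂ) :
    quadForm t ρ σ ((hρ.eigenvectorUnitary : Matrix A A ℂ) * Y *
        (hσ.eigenvectorUnitary : Matrix A A ℂ)ᴴ) =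
      ∑ i, ∑ j, (2 * hρ.eigenvalues i * (Y i j * star (overlap hρ hσ i j)).re -
        (t * hρ.eigenvalues i + hσ.eigenvalues j) * Complex.normSq (Y i j)) := by
  set U := (hρ.eigenvectorUnitary : Matrix A A ℂ) with hU
  set W := (hσ.eigenvectorUnitary : Matrix A A ℂ) with hW
  have hUU : Uᴴ * U = 1 := eigenvectorUnitary_conjTranspose_mul hρ
  have hWW : Wᴴ * W = 1 := eigenvectorUnitary_conjTranspose_mul hσ
  have c1 (Z : Matrix A A ℂ) : Uᴴ * (U * Z) = Z := by rw [← Matrix.mul_assoc, hUU, Matrix.one_mul]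
  have c2 (Z : Matrix A A ℂ) : Wᴴ * (W * Z) = Z := by rw [← Matrix.mul_assoc, hWW, Matrix.one_mul]
  have e1 : (ρ * (U * Y * Wᴴ)).trace =
      (diagonal (fun i => (hρ.eigenvalues i : ℂ)) * (Y * (overlap hρ hσ)ᴴ)).trace := by
    conv_lhs => rw [eq_conj_diagonal hρ]
    rw [← hU, overlap, ← hU, ← hW, conjTranspose_mul, conjTranspose_conjTranspose]
    simp only [Matrix.mul_assoc, c1]
    rw [trace_mul_comm]
    simp only [Matrix.mul_assoc]
  have e2 : ((U * Y * Wᴴ)ᴴ * ρ * (U * Y * Wᴴ)).trace =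
      (diagonal (fun i => (hρ.eigenvalues i : ℂ)) * (Y * Yᴴ)).trace := by
    conv_lhs => rw [eq_conj_diagonal hρ]
    rw [← hU, conjTranspose_mul, conjTranspose_mul, conjTranspose_conjTranspose]
    simp only [Matrix.mul_assoc, c1]
    rw [trace_mul_comm]
    simp only [Matrix.mul_assoc, hWW, Matrix.mul_one]
    rw [trace_mul_comm]
    simp only [Matrix.mul_assoc]
  have e3 : ((U * Y * Wᴴ) * σ * (U * Y * Wᴴ)ᴴ).trace =
      (Y * diagonal (fun i => (hσ.eigenvalues i : ℂ)) * Yᴴ).trace := by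
    conv_lhs => rw [eq_conj_diagonal hσ]
    rw [← hW, conjTranspose_mul, conjTranspose_mul, conjTranspose_conjTranspose]
    simp only [Matrix.mul_assoc, c2]
    rw [trace_mul_comm]
    simp only [Matrix.mul_assoc, hUU, Matrix.mul_one]
  have f1 : (diagonal (fun i => (hρ.eigenvalues i : ℂ)) * (Y * (overlap hρ hσ)ᴴ)).trace.re =
      ∑ i, ∑ j, hρ.eigenvalues i * (Y i j * star (overlap hρ hσ i j)).re := by
    rw [Matrix.trace, Complex.re_sum]
    refine Finset.sum_congr rfl fun i _ => ?_
    rw [diag_apply, diagonal_mul, Complex.re_ofReal_mul, Matrix.mul_apply, Complex.re_sum,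
      Finset.mul_sum]
    rfl
  have f2 : (diagonal (fun i => (hρ.eigenvalues i : ℂ)) * (Y * Yᴴ)).trace.re =
      ∑ i, ∑ j, Complex.normSq (Y i j) * hρ.eigenvalues i := by
    have := trace_diagonal_mul_mul_diagonal_mul hρ.eigenvalues (fun _ => 1) Y
    simpa [Matrix.mul_assoc] using this
  have f3 : (Y * diagonal (fun i => (hσ.eigenvalues i : ℂ)) * Yᴴ).trace.re =
      ∑ i, ∑ j, Complex.normSq (Y i j) * hσ.eigenvalues j := by
    have := trace_diagonal_mul_mul_diagonal_mul (fun _ => 1) hσ.eigenvalues Y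
    simpa using this
  rw [quadForm, e1, e2, e3, f1, f2, f3]
  simp only [Finset.mul_sum, ← Finset.sum_sub_distrib]
  refine Finset.sum_congr rfl fun i _ => Finset.sum_congr rfl fun j _ => ?_
  ring

lemma two_mul_re_sub_le (p d : ℝ) (hd : 0 ≤ d) (hpd : d = 0 → p = 0) (y g : ℂ) :
    2 * p * (y * star g).re - d * Complex.normSq y ≤ Complex.normSq g * p * p / d := by
  rcases hd.eq_or_lt with hd0 | hd0
  · rw [← hd0, hpd hd0.symm]
    simp
  · rw [le_div_iff₀ hd0]
    -- Completing the square; the maximizer is `y = p g / d`.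
    have h := Complex.normSq_nonneg ((d : ℂ) * y - p * g)
    simp only [Complex.normSq_apply, Complex.sub_re, Complex.sub_im, Complex.ofReal_re,
      Complex.ofReal_im, Complex.mul_re, Complex.mul_im, Complex.star_def, Complex.conj_re,
      Complex.conj_im] at h ⊢
    nlinarith

lemma quadForm_le_resolventForm {ρ σ : Matrix A A ℂ} (hρ : ρ.PosSemidef) (hσ : σ.PosSemidef)
    {t : ℝ} (ht : 0 < t) (X : Matrix A A ℂ) :
    quadForm t ρ σ X ≤ resolventForm hρ.1 hσ.1 t := by
  have hX : X = (hρ.1.eigenvectorUnitary : Matrix A A ℂ) *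
      ((hρ.1.eigenvectorUnitary : Matrix A A ℂ)ᴴ * X * (hσ.1.eigenvectorUnitary : Matrix A A ℂ)) *
      (hσ.1.eigenvectorUnitary : Matrix A A ℂ)ᴴ := by
    simp only [Matrix.mul_assoc, eigenvectorUnitary_mul_conjTranspose, Matrix.mul_one]
    rw [← Matrix.mul_assoc, eigenvectorUnitary_mul_conjTranspose, Matrix.one_mul]
  rw [hX, quadForm_conj]
  refine Finset.sum_le_sum fun i _ => Finset.sum_le_sum fun j _ => ?_
  have hp := hρ.eigenvalues_nonneg i
  have hq := hσ.eigenvalues_nonneg j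
  refine two_mul_re_sub_le _ _ (by positivity) (fun h => ?_) _ _
  have : t * hρ.1.eigenvalues i = 0 := le_antisymm (by linarith) (by positivity)
  exact (mul_eq_zero.mp this).resolve_left ht.ne'

lemma exists_quadForm_eq_resolventForm {ρ σ : Matrix A A ℂ} (hρ : ρ.IsHermitian)
    (hσ : σ.IsHermitian) (t : ℝ) : ∃ X, quadForm t ρ σ X = resolventForm hρ hσ t := by
  -- The entrywise maximizer `pᵢ gᵢⱼ / (t pᵢ + qⱼ)`; if the denominator vanishes, division by zero
  -- makes both sides zero.
  refine ⟨_, (quadForm_conj hρ hσ t (Matrix.of fun i j =>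
    ((hρ.eigenvalues i / (t * hρ.eigenvalues i + hσ.eigenvalues j) : ℝ) : ℂ) *
      overlap hρ hσ i j)).trans ?_⟩
  refine Finset.sum_congr rfl fun i _ => Finset.sum_congr rfl fun j _ => ?_
  rw [Matrix.of_apply, mul_assoc (Complex.ofReal _), Complex.star_def, Complex.mul_conj, map_mul,
    ← Complex.ofReal_mul, Complex.ofReal_re, Complex.normSq_ofReal]
  rcases eq_or_ne (t * hρ.eigenvalues i + hσ.eigenvalues j) 0 with h | h
  · simp [h]
  · field_simp
    ring

lemma quadForm_sum {ι : Type*} (s : Finset ι) (t : ℝ) (ρ σ : ι → Matrix A A ℂ)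
    (X : Matrix A A ℂ) :
    quadForm t (∑ k ∈ s, ρ k) (∑ k ∈ s, σ k) X = ∑ k ∈ s, quadForm t (ρ k) (σ k) X := by
  simp only [quadForm, Finset.sum_mul, Finset.mul_sum, trace_sum, Complex.re_sum,
    Finset.sum_sub_distrib]

/-- A maximum of functionals additive in `(ρ, σ)` is subadditive: the maximizer for the sums is a
trial matrix for each summand. -/
lemma resolventForm_sum_le {ι : Type*} [Fintype ι] {ρ σ : ι → Matrix A A ℂ}
    (hρ : ∀ k, (ρ k).PosSemidef) (hσ : ∀ k, (σ k).PosSemidef)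
    (hρs : (∑ k, ρ k).IsHermitian) (hσs : (∑ k, σ k).IsHermitian) {t : ℝ} (ht : 0 < t) :
    resolventForm hρs hσs t ≤ ∑ k, resolventForm (hρ k).1 (hσ k).1 t := by
  obtain ⟨X, hX⟩ := exists_quadForm_eq_resolventForm hρs hσs t
  rw [← hX, quadForm_sum]
  exact Finset.sum_le_sum fun k _ => quadForm_le_resolventForm (hρ k) (hσ k) ht X

/-- The integral of `resolventForm` from `0` to `t`. -/
def integratedForm {ρ σ : Matrix A A ℂ} (hρ : ρ.IsHermitian) (hσ : σ.IsHermitian) (t : ℝ) : ℝ :=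
  ∑ i, ∑ j, Complex.normSq (overlap hρ hσ i j) * hρ.eigenvalues i *
    (Real.log (t * hρ.eigenvalues i + hσ.eigenvalues j) - Real.log (hσ.eigenvalues j))

lemma integratedForm_zero {ρ σ : Matrix A A ℂ} (hρ : ρ.IsHermitian) (hσ : σ.IsHermitian) :
    integratedForm hρ hσ 0 = 0 := by
  simp [integratedForm]

lemma hasDerivAt_integratedForm {ρ σ : Matrix A A ℂ} (hρ : ρ.PosSemidef) (hσ : σ.PosSemidef)
    (h : ∀ v, σ *ᵥ v = 0 → ρ *ᵥ v = 0) {t : ℝ} (ht : 0 ≤ t) :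
    HasDerivAt (integratedForm hρ.1 hσ.1) (resolventForm hρ.1 hσ.1 t) t := by
  refine HasDerivAt.fun_sum fun i _ => HasDerivAt.fun_sum fun j _ => ?_
  have hp := hρ.eigenvalues_nonneg i
  rcases (hσ.eigenvalues_nonneg j).eq_or_lt with hq | hq
  · rw [overlap_eq_zero_of_ker hρ.1 hσ.1 h i j hq.symm]
    simpa using hasDerivAt_const t (0 : ℝ)
  · have hd : t * hρ.1.eigenvalues i + hσ.1.eigenvalues j ≠ 0 := by positivity
    have h1 : HasDerivAt (fun t => t * hρ.1.eigenvalues i + hσ.1.eigenvalues j)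
        (hρ.1.eigenvalues i) t := by
      simpa using ((hasDerivAt_id t).mul_const (hρ.1.eigenvalues i)).add_const (hσ.1.eigenvalues j)
    have h2 := ((h1.log hd).sub_const (Real.log (hσ.1.eigenvalues j))).const_mul
      (Complex.normSq (overlap hρ.1 hσ.1 i j) * hρ.1.eigenvalues i)
    rwa [← mul_div_assoc] at h2

/-- Both sides vanish at `0` and their derivatives are ordered by `resolventForm_sum_le`, so
monotonicity replaces integration. -/
lemma integratedForm_sum_le {ι : Type*} [Fintype ι] {ρ σ : ι → Matrix A A ℂ}
    (hρ : ∀ k, (ρ k).PosSemidef) (hσ : ∀ k, (σ k).PosSemidef)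
    (h : ∀ k v, σ k *ᵥ v = 0 → ρ k *ᵥ v = 0)
    (hρs : (∑ k, ρ k).PosSemidef) (hσs : (∑ k, σ k).PosSemidef)
    (hs : ∀ v, (∑ k, σ k) *ᵥ v = 0 → (∑ k, ρ k) *ᵥ v = 0) {t : ℝ} (ht : 0 ≤ t) :
    integratedForm hρs.1 hσs.1 t ≤ ∑ k, integratedForm (hρ k).1 (hσ k).1 t := by
  have hd (s : ℝ) (hs0 : 0 ≤ s) := (HasDerivAt.fun_sum (u := Finset.univ) fun k _ =>
    hasDerivAt_integratedForm (hρ k) (hσ k) (h k) hs0).sub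
      (hasDerivAt_integratedForm hρs hσs hs hs0)
  have hm := monotoneOn_of_deriv_nonneg (convex_Ici (0 : ℝ))
    (fun s hs0 => (hd s hs0).continuousAt.continuousWithinAt)
    (fun s hs0 => (hd s (interior_subset hs0)).differentiableAt.differentiableWithinAt)
    (fun s hs0 => by
      rw [interior_Ici] at hs0
      rw [(hd s (le_of_lt hs0)).deriv, sub_nonneg]
      exact resolventForm_sum_le hρ hσ hρs.1 hσs.1 hs0)
  have h0 := hm (Set.mem_Ici.mpr le_rfl) (Set.mem_Ici.mpr ht) ht
  simp only [Pi.sub_apply, integratedForm_zero, Finset.sum_const_zero, sub_zero] at h0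
  linarith

open Filter Topology in
-- For `p > 0`, `log (t p + q) - log t → log p`, and the weights sum to `Tr ρ`. Removing the
-- divergence leaves the relative entropy in natural units.
lemma tendsto_integratedForm {ρ σ : Matrix A A ℂ} (hρ : ρ.PosSemidef) (hσ : σ.PosSemidef) :
    Tendsto (fun t => integratedForm hρ.1 hσ.1 t - Real.log t * ρ.trace.re) atTop
      (𝓝 (∑ i, ∑ j, Complex.normSq (overlap hρ.1 hσ.1 i j) * hρ.1.eigenvalues i *
        (Real.log (hρ.1.eigenvalues i) - Real.log (hσ.1.eigenvalues j)))) := by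
  simp only [← sum_normSq_overlap hρ.1 hσ.1, integratedForm, Finset.mul_sum,
    ← Finset.sum_sub_distrib]
  refine tendsto_finsetSum _ fun i _ => tendsto_finsetSum _ fun j _ => ?_
  have hq := hσ.eigenvalues_nonneg j
  rcases (hρ.eigenvalues_nonneg i).eq_or_lt with hp | hp
  · simp [← hp]
  · have h1 : Tendsto (fun t : ℝ => Real.log (hρ.1.eigenvalues i + hσ.1.eigenvalues j * t⁻¹)) atTop
        (𝓝 (Real.log (hρ.1.eigenvalues i))) := by
      have h2 : Tendsto (fun t : ℝ => hρ.1.eigenvalues i + hσ.1.eigenvalues j * t⁻¹) atTop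
          (𝓝 (hρ.1.eigenvalues i)) := by
        simpa using (tendsto_inv_atTop_zero.const_mul (hσ.1.eigenvalues j)).const_add
          (hρ.1.eigenvalues i)
      exact h2.log hp.ne'
    refine ((h1.sub_const _).const_mul _).congr' ?_
    filter_upwards [eventually_gt_atTop 0] with t ht
    have h3 : t * hρ.1.eigenvalues i + hσ.1.eigenvalues j =
        t * (hρ.1.eigenvalues i + hσ.1.eigenvalues j * t⁻¹) := by
      field_simp
    rw [h3, Real.log_mul ht.ne' (by positivity)]
    ring

/-- **Joint convexity of the quantum relative entropy**, in its homogeneous form. -/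
theorem trace_mul_log2_sub_log2_sum_le {ι : Type*} [Fintype ι] {ρ σ : ι → Matrix A A ℂ}
    (hρ : ∀ k, (ρ k).PosSemidef) (hσ : ∀ k, (σ k).PosSemidef)
    (h : ∀ k v, σ k *ᵥ v = 0 → ρ k *ᵥ v = 0)
    (hs : ∀ v, (∑ k, σ k) *ᵥ v = 0 → (∑ k, ρ k) *ᵥ v = 0) :
    ((∑ k, ρ k) * (log2 (∑ k, ρ k) - log2 (∑ k, σ k))).trace.re ≤
      ∑ k, (ρ k * (log2 (ρ k) - log2 (σ k))).trace.re := by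
  have hρs : (∑ k, ρ k).PosSemidef := posSemidef_sum _ fun k _ => hρ k
  have hσs : (∑ k, σ k).PosSemidef := posSemidef_sum _ fun k _ => hσ k
  rw [trace_mul_log2_sub_log2 hρs.1 hσs.1]
  simp only [fun k => trace_mul_log2_sub_log2 (hρ k).1 (hσ k).1]
  rw [← Finset.sum_div]
  refine div_le_div_of_nonneg_right ?_ (Real.log_nonneg one_le_two)
  refine le_of_tendsto_of_tendsto (tendsto_integratedForm hρs hσs)
    (tendsto_finsetSum _ fun k _ => tendsto_integratedForm (hρ k) (hσ k)) ?_
  filter_upwards [Filter.eventually_ge_atTop 0] with t ht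
  -- The divergent terms `log t · Tr ρ` are additive in `ρ`, so they cancel from the comparison.
  rw [Finset.sum_sub_distrib, ← Finset.mul_sum, trace_sum, Complex.re_sum]
  exact sub_le_sub_right (integratedForm_sum_le hρ hσ h hρs hσs hs ht) _

/-- **Klein's inequality**. -/
lemma trace_mul_log2_sub_log2_nonneg {ρ σ : Matrix A A ℂ} (hρ : ρ.PosSemidef) (hσ : σ.PosSemidef)
    (h : ∀ v, σ *ᵥ v = 0 → ρ *ᵥ v = 0) (ht : σ.trace = ρ.trace) :
    0 ≤ (ρ * (log2 ρ - log2 σ)).trace.re := by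
  rw [trace_mul_log2_sub_log2 hρ.1 hσ.1]
  refine div_nonneg ?_ (Real.log_nonneg one_le_two)
  have h0 : ∑ i, ∑ j, (Complex.normSq (overlap hρ.1 hσ.1 i j) * hρ.1.eigenvalues i -
      Complex.normSq (overlap hρ.1 hσ.1 i j) * hσ.1.eigenvalues j) = 0 := by
    simp only [Finset.sum_sub_distrib]
    rw [sum_normSq_overlap, sum_normSq_overlap', ht, sub_self]
  rw [← h0]
  refine Finset.sum_le_sum fun i _ => Finset.sum_le_sum fun j _ => ?_
  have hw := Complex.normSq_nonneg (overlap hρ.1 hσ.1 i j)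
  rcases (hσ.eigenvalues_nonneg j).eq_or_lt with hq | hq
  · rw [overlap_eq_zero_of_ker hρ.1 hσ.1 h i j hq.symm, ← hq]
    simp
  · rcases (hρ.eigenvalues_nonneg i).eq_or_lt with hp | hp
    · rw [← hp]
      have := mul_nonneg hw hq.le
      simpa using this
    · rw [mul_assoc, ← mul_sub]
      refine mul_le_mul_of_nonneg_left ?_ hw
      -- The scalar inequality is `p (log p - log q) ≥ p - q`, from `log x ≤ x - 1` at `x = q / p`;
      -- summed, the right sides give `Tr ρ - Tr σ = 0`.
      have h1 := Real.log_le_sub_one_of_pos (div_pos hq hp)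
      rw [Real.log_div hq.ne' hp.ne'] at h1
      have h2 := mul_le_mul_of_nonneg_left h1 hp.le
      have h3 : hρ.1.eigenvalues i * (hσ.1.eigenvalues j / hρ.1.eigenvalues i - 1) =
        hσ.1.eigenvalues j - hρ.1.eigenvalues i := by field_simp
      linarith

/-! ### Scaling -/

/-- The rule `log (c q) = log c + log q` fails at `q = 0`; the kernel hypothesis removes exactly
those terms. -/
lemma trace_mul_log2_smul {ρ σ : Matrix A A ℂ} (hρ : ρ.IsHermitian) (hσ : σ.IsHermitian)
    (h : ∀ v, σ *ᵥ v = 0 → ρ *ᵥ v = 0) {c : ℝ} (hc : c ≠ 0) :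
    (ρ * log2 (c • σ)).trace.re = Real.logb 2 c * ρ.trace.re + (ρ * log2 σ).trace.re := by
  have h1 : log2 (c • σ) = cfc (fun x => Real.logb 2 (c * x)) σ :=
    (cfc_comp_const_mul c (Real.logb 2) σ ((σ.finite_real_spectrum.image _).continuousOn _)
      hσ).symm
  rw [h1, log2, trace_mul_cfc hρ hσ, trace_mul_cfc hρ hσ, ← sum_normSq_overlap hρ hσ]
  simp only [Finset.mul_sum, ← Finset.sum_add_distrib]
  refine Finset.sum_congr rfl fun i _ => Finset.sum_congr rfl fun j _ => ?_
  rcases eq_or_ne (hσ.eigenvalues j) 0 with hq | hq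
  · rw [overlap_eq_zero_of_ker hρ hσ h i j hq]
    simp
  · rw [Real.logb_mul hc hq]
    ring

lemma entropy_smul {ρ : Matrix A A ℂ} (hρ : ρ.IsHermitian) {c : ℝ} (hc : c ≠ 0) :
    entropy (c • ρ) = c * entropy ρ - c * Real.logb 2 c * ρ.trace.re := by
  rw [entropy, entropy, Matrix.smul_mul, trace_smul, Complex.smul_re,
    trace_mul_log2_smul hρ hρ (fun _ h => h) hc, smul_eq_mul]
  ring

lemma entropy_zero : entropy (0 : Matrix A A ℂ) = 0 := by
  simp [entropy]

/-! ### Partial traces -/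

lemma traceSnd_eq_sum (ω : Matrix (R × B) (R × B) ℂ) :
    traceSnd R B ω = ∑ b, ω.submatrix (fun r => (r, b)) (fun r => (r, b)) := by
  ext r r'
  simp [traceSnd, Matrix.sum_apply]

lemma traceSnd_posSemidef {ω : Matrix (R × B) (R × B) ℂ} (hω : ω.PosSemidef) :
    (traceSnd R B ω).PosSemidef := by
  rw [traceSnd_eq_sum]
  exact posSemidef_sum _ fun b _ => hω.submatrix _

lemma traceFst_posSemidef {ω : Matrix (R × B) (R × B) ℂ} (hω : ω.PosSemidef) :
    (traceFst R B ω).PosSemidef := by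
  have : traceFst R B ω = ∑ r, ω.submatrix (fun b => (r, b)) (fun b => (r, b)) := by
    ext r r'
    simp [traceFst, Matrix.sum_apply]
  rw [this]
  exact posSemidef_sum _ fun b _ => hω.submatrix _

lemma trace_traceSnd (ω : Matrix (R × B) (R × B) ℂ) : (traceSnd R B ω).trace = ω.trace := by
  simp [traceSnd, Matrix.trace, Fintype.sum_prod_type]

lemma trace_traceFst (ω : Matrix (R × B) (R × B) ℂ) : (traceFst R B ω).trace = ω.trace := by
  simp [traceFst, Matrix.trace, Fintype.sum_prod_type_right]

lemma trace_mul_kronecker_one (ω : Matrix (R × B) (R × B) ℂ) (X : Matrix R R ℂ) :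
    (ω * (X ⊗ₖ (1 : Matrix B B ℂ))).trace = (traceSnd R B ω * X).trace := by
  simp only [Matrix.trace, diag_apply, Matrix.mul_apply, traceSnd, LinearMap.coe_mk,
    AddHom.coe_mk, Matrix.of_apply, Fintype.sum_prod_type, kroneckerMap_apply, Finset.sum_mul]
  refine Finset.sum_congr rfl fun r _ => ?_
  rw [Finset.sum_comm]
  refine Finset.sum_congr rfl fun r' _ => Finset.sum_congr rfl fun b _ => ?_
  rw [Finset.sum_eq_single b]
  · simp
  · intro b' _ hb
    simp [hb]
  · simp

/-- The homomorphism `X ↦ X ⊗ 1`. -/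
def ampliation (R B : Type*) [Fintype R] [DecidableEq R] [Fintype B] [DecidableEq B] :
    Matrix R R ℂ →ₐ[ℝ] Matrix (R × B) (R × B) ℂ :=
  AlgHom.ofLinearMap
    { toFun := fun X => X ⊗ₖ (1 : Matrix B B ℂ)
      map_add' := fun X Y => add_kronecker X Y 1
      map_smul' := fun c X => smul_kronecker c X 1 }
    one_kronecker_one (fun X Y => by
      change (X * Y) ⊗ₖ (1 : Matrix B B ℂ) = (X ⊗ₖ 1) * (Y ⊗ₖ 1)
      rw [← mul_kronecker_mul, Matrix.one_mul])

lemma log2_kronecker_one {σ : Matrix R R ℂ} (hσ : σ.IsHermitian) :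
    log2 (σ ⊗ₖ (1 : Matrix B B ℂ)) = log2 σ ⊗ₖ (1 : Matrix B B ℂ) :=
  cfc_algHom (ampliation R B) hσ (by
    change (σ ⊗ₖ (1 : Matrix B B ℂ)).IsHermitian
    rw [IsHermitian, conjTranspose_kronecker, hσ.eq, conjTranspose_one]) (Real.logb 2)

/-- This gives `supp ω ⊆ supp (ω_R ⊗ 1)`. Each slice `v_b` is killed by `ω_R`, a sum of positive
diagonal blocks, hence by every block. So `v_b ⊗ e_b` has zero expectation in `ω ≥ 0` and lies in
its kernel. -/
lemma mulVec_eq_zero_of_traceSnd {ω : Matrix (R × B) (R × B) ℂ} (hω : ω.PosSemidef)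
    (v : R × B → ℂ) (hv : (traceSnd R B ω ⊗ₖ (1 : Matrix B B ℂ)) *ᵥ v = 0) : ω *ᵥ v = 0 := by
  have h1 (b : B) : traceSnd R B ω *ᵥ (fun r => v (r, b)) = 0 := by
    ext r
    have h := congrFun hv (r, b)
    simp only [mulVec, dotProduct, Fintype.sum_prod_type, kroneckerMap_apply] at h ⊢
    rw [Pi.zero_apply] at h ⊢
    rw [← h]
    refine Finset.sum_congr rfl fun r' _ => ?_
    rw [Finset.sum_eq_single b]
    · simp
    · intro b' _ hb
      simp [hb.symm]
    · simp
  have h2 (b b' : B) : ω.submatrix (fun r => (r, b')) (fun r => (r, b')) *ᵥ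
      (fun r => v (r, b)) = 0 := by
    have hs : ∀ b', (ω.submatrix (fun r => (r, b')) (fun r => (r, b'))).PosSemidef :=
      fun b' => hω.submatrix _
    have h3 := congrArg (fun x => star (fun r => v (r, b)) ⬝ᵥ x) (h1 b)
    simp only [traceSnd_eq_sum, sum_mulVec, dotProduct_sum, dotProduct_zero] at h3
    have h4 := (Finset.sum_eq_zero_iff_of_nonneg fun b' _ =>
      (hs b').dotProduct_mulVec_nonneg (fun r => v (r, b))).mp h3 b' (Finset.mem_univ _)
    exact ((hs b').dotProduct_mulVec_zero_iff _).mp h4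
  have h5 (b : B) : ω *ᵥ (fun p => if p.2 = b then v (p.1, b) else 0) = 0 := by
    refine (hω.dotProduct_mulVec_zero_iff _).mp ?_
    have h6 : star (fun r => v (r, b)) ⬝ᵥ
        (ω.submatrix (fun r => (r, b)) (fun r => (r, b)) *ᵥ (fun r => v (r, b))) = 0 := by
      rw [h2, dotProduct_zero]
    refine Eq.trans ?_ h6
    simp only [dotProduct, mulVec, Fintype.sum_prod_type, Pi.star_apply, submatrix_apply]
    refine Finset.sum_congr rfl fun r _ => ?_
    rw [Finset.sum_eq_single b]
    · simp
    · intro b' _ hb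
      simp [hb]
    · simp
  have h7 : v = ∑ b, fun p => if p.2 = b then v (p.1, b) else 0 := by
    ext p
    simp [Finset.sum_apply]
  rw [h7, mulVec_sum]
  exact Finset.sum_eq_zero fun b _ => h5 b

/-! ### The conditional entropy -/

/-- The identity `H(B|R) = -D(ω‖ω_R ⊗ 1)` is how convexity and positivity of relative entropy reach
the conditional entropy. -/
lemma condEntropyGivenFst_eq_neg {ω : Matrix (R × B) (R × B) ℂ} (hω : ω.PosSemidef) :
    condEntropyGivenFst ω =
      -(ω * (log2 ω - log2 (traceSnd R B ω ⊗ₖ (1 : Matrix B B ℂ)))).trace.re := by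
  rw [condEntropyGivenFst, entropy, entropy, log2_kronecker_one (traceSnd_posSemidef hω).1,
    Matrix.mul_sub, trace_sub, trace_mul_kronecker_one, Complex.sub_re]
  ring

lemma kronecker_one_posSemidef {σ : Matrix R R ℂ} (hσ : σ.PosSemidef) :
    (σ ⊗ₖ (1 : Matrix B B ℂ)).PosSemidef :=
  hσ.kronecker PosSemidef.one

/-- Concavity of the conditional entropy, in its homogeneous form. -/
lemma sum_condEntropyGivenFst_le {ι : Type*} [Fintype ι] {ω : ι → Matrix (R × B) (R × B) ℂ}
    (hω : ∀ k, (ω k).PosSemidef) :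
    ∑ k, condEntropyGivenFst (ω k) ≤ condEntropyGivenFst (∑ k, ω k) := by
  have hs : (∑ k, ω k).PosSemidef := posSemidef_sum _ fun k _ => hω k
  have hsum : traceSnd R B (∑ k, ω k) ⊗ₖ (1 : Matrix B B ℂ) =
      ∑ k, traceSnd R B (ω k) ⊗ₖ (1 : Matrix B B ℂ) := by
    rw [map_sum]
    exact map_sum (ampliation R B) _ _
  rw [condEntropyGivenFst_eq_neg hs]
  simp only [fun k => condEntropyGivenFst_eq_neg (hω k)]
  rw [Finset.sum_neg_distrib, neg_le_neg_iff, hsum]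
  refine trace_mul_log2_sub_log2_sum_le hω
    (fun k => kronecker_one_posSemidef (traceSnd_posSemidef (hω k)))
    (fun k => mulVec_eq_zero_of_traceSnd (hω k)) fun v hv => ?_
  rw [← hsum] at hv
  exact mulVec_eq_zero_of_traceSnd hs v hv

lemma trace_mul_log2_sub_log2_smul_kronecker {ω : Matrix (R × B) (R × B) ℂ} (hω : IsState ω)
    {c : ℝ} (hc : c ≠ 0) :
    (ω * (log2 ω - log2 (c • (traceSnd R B ω ⊗ₖ (1 : Matrix B B ℂ))))).trace.re =
      -Real.logb 2 c - condEntropyGivenFst ω := by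
  rw [condEntropyGivenFst_eq_neg hω.1, Matrix.mul_sub, Matrix.mul_sub, trace_sub, trace_sub,
    Complex.sub_re, Complex.sub_re, trace_mul_log2_smul hω.1.1
      (kronecker_one_posSemidef (traceSnd_posSemidef hω.1)).1
      (mulVec_eq_zero_of_traceSnd hω.1) hc, hω.2, Complex.one_re]
  ring

lemma nonempty_of_isState {ρ : Matrix A A ℂ} (hρ : IsState ρ) : Nonempty A := by
  by_contra h
  rw [not_nonempty_iff] at h
  simpa [Matrix.trace] using hρ.2

lemma card_ne_zero_of_isState {ω : Matrix (R × B) (R × B) ℂ} (hω : IsState ω) :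
    (Fintype.card B : ℝ) ≠ 0 := by
  obtain ⟨_, b⟩ := nonempty_of_isState hω
  have : Nonempty B := ⟨b⟩
  exact Nat.cast_ne_zero.mpr Fintype.card_ne_zero

lemma condEntropyGivenFst_le {ω : Matrix (R × B) (R × B) ℂ} (hω : IsState ω) :
    condEntropyGivenFst ω ≤ Real.logb 2 (Fintype.card B) := by
  have hc := card_ne_zero_of_isState hω
  have h := trace_mul_log2_sub_log2_smul_kronecker hω (inv_ne_zero hc)
  rw [Real.logb_inv, neg_neg] at h
  rw [← sub_nonneg, ← h]
  refine trace_mul_log2_sub_log2_nonneg hω.1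
    ((kronecker_one_posSemidef (traceSnd_posSemidef hω.1)).smul (by positivity)) ?_ ?_
  · intro v hv
    rw [smul_mulVec] at hv
    exact mulVec_eq_zero_of_traceSnd hω.1 v ((smul_eq_zero.mp hv).resolve_left (inv_ne_zero hc))
  · rw [trace_smul, trace_kronecker, trace_traceSnd, hω.2, trace_one, one_mul]
    rw [← Complex.coe_smul, smul_eq_mul]
    push_cast
    exact inv_mul_cancel₀ (by exact_mod_cast hc)

/-- With `0⁻¹ = 0`, the functional calculus of `x⁻¹` is the pseudo-inverse `s` of `σ`. The kernel
condition gives `ρ s σ = ρ`, and its adjoint exhibits the range of `ρ` inside that of `σ`. -/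
lemma supp_le_supp_of_ker {ρ σ : Matrix A A ℂ} (hρ : ρ.IsHermitian) (hσ : σ.IsHermitian)
    (h : ∀ v, σ *ᵥ v = 0 → ρ *ᵥ v = 0) : supp ρ ≤ supp σ := by
  have hc (f : ℝ → ℝ) : ContinuousOn f (spectrum ℝ σ) := σ.finite_real_spectrum.continuousOn f
  have h1 : σ * cfc (fun x : ℝ => x⁻¹) σ * σ = σ := by
    have h2 : cfc (fun x : ℝ => x) σ = σ := cfc_id' ℝ σ hσ
    nth_rw 1 3 4 [← h2]
    rw [← cfc_mul _ _ σ (hc _) (hc _), ← cfc_mul _ _ σ (hc _) (hc _)]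
    exact cfc_congr fun x _ => mul_inv_mul_cancel x
  have h3 : ρ * (cfc (fun x : ℝ => x⁻¹) σ * σ) = ρ := by
    have h4 : ρ * (1 - cfc (fun x : ℝ => x⁻¹) σ * σ) = 0 := by
      refine ext_of_mulVec_single fun j => ?_
      rw [← mulVec_mulVec, zero_mulVec]
      refine h _ ?_
      rw [mulVec_mulVec, Matrix.mul_sub, ← Matrix.mul_assoc, h1, Matrix.mul_one, sub_self,
        zero_mulVec]
    rw [Matrix.mul_sub, Matrix.mul_one, sub_eq_zero] at h4
    exact h4.symm
  have h5 : σ * ((cfc (fun x : ℝ => x⁻¹) σ)ᴴ * ρ) = ρ := by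
    have := congrArg conjTranspose h3
    rwa [conjTranspose_mul, conjTranspose_mul, hσ.eq, hρ.eq, Matrix.mul_assoc] at this
  rintro _ ⟨v, rfl⟩
  refine ⟨((cfc (fun x : ℝ => x⁻¹) σ)ᴴ * ρ) *ᵥ v, ?_⟩
  rw [mulVecLin_apply, mulVecLin_apply, mulVec_mulVec, h5]

lemma relEntropy_smul_kronecker {ω : Matrix (R × B) (R × B) ℂ} (hω : IsState ω) :
    relEntropy ω ((Fintype.card B : ℝ)⁻¹ • (traceSnd R B ω ⊗ₖ (1 : Matrix B B ℂ))) =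
      ((Real.logb 2 (Fintype.card B) - condEntropyGivenFst ω : ℝ) : EReal) := by
  have hc := card_ne_zero_of_isState hω
  rw [relEntropy, if_pos, trace_mul_log2_sub_log2_smul_kronecker hω (inv_ne_zero hc),
    Real.logb_inv, neg_neg]
  refine supp_le_supp_of_ker hω.1.1
    ((kronecker_one_posSemidef (traceSnd_posSemidef hω.1)).smul (by positivity)).1 fun v hv => ?_
  rw [smul_mulVec] at hv
  exact mulVec_eq_zero_of_traceSnd hω.1 v ((smul_eq_zero.mp hv).resolve_left (inv_ne_zero hc))

lemma entropy_submatrix {ρ : Matrix A A ℂ} (hρ : ρ.PosSemidef) (e : B ≃ A) :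
    entropy (ρ.submatrix e e) = entropy ρ := by
  obtain ⟨M, rfl⟩ := exists_eq_conjTranspose_mul hρ
  have h1 : (Mᴴ * M).submatrix e e = (M.submatrix id e)ᴴ * M.submatrix id e := by
    rw [conjTranspose_submatrix, submatrix_mul _ _ _ id _ Function.bijective_id]
  have h2 : M.submatrix id e * (M.submatrix id e)ᴴ = M * Mᴴ := by
    rw [conjTranspose_submatrix, submatrix_mul_equiv, submatrix_id_id]
  rw [h1, ← entropy_mul_conjTranspose, h2, entropy_mul_conjTranspose]

lemma condEntropyGivenSnd_le {τ : Matrix (B × E) (B × E) ℂ} (hτ : IsState τ) :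
    condEntropyGivenSnd τ ≤ Real.logb 2 (Fintype.card B) := by
  have h1 : IsState (τ.submatrix (Equiv.prodComm E B) (Equiv.prodComm E B)) := by
    refine ⟨hτ.1.submatrix _, ?_⟩
    rw [← hτ.2]
    exact (Equiv.prodComm E B).sum_comp fun p => τ p p
  have h2 := condEntropyGivenFst_le h1
  rwa [condEntropyGivenFst, entropy_submatrix hτ.1] at h2

/-! ### Channels and their isometric extensions -/

lemma traceSnd_idTensor {N : Matrix A A ℂ →ₗ[ℂ] Matrix B B ℂ} (hN : IsChannel N)
    (X : Matrix (R × A) (R × A) ℂ) : traceSnd R B (idTensor R N X) = traceSnd R A X := by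
  ext r r'
  exact hN.trace_preserving (Matrix.of fun a a' => X (r, a) (r', a'))

lemma isState_idTensor {N : Matrix A A ℂ →ₗ[ℂ] Matrix B B ℂ} (hN : IsChannel N) {n : ℕ}
    {ρ : Matrix (Fin n × A) (Fin n × A) ℂ} (hρ : IsState ρ) :
    IsState (idTensor (Fin n) N ρ) :=
  ⟨hN.completely_positive n ρ hρ.1, by
    rw [← trace_traceSnd, traceSnd_idTensor hN, trace_traceSnd, hρ.2]⟩

lemma idTensor_sum {ι : Type*} (s : Finset ι) (N : Matrix A A ℂ →ₗ[ℂ] Matrix B B ℂ)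
    (X : ι → Matrix (R × A) (R × A) ℂ) :
    idTensor R N (∑ k ∈ s, X k) = ∑ k ∈ s, idTensor R N (X k) := by
  ext p q
  have h : (Matrix.of fun a a' => (∑ k ∈ s, X k) (p.1, a) (q.1, a')) =
      ∑ k ∈ s, Matrix.of fun a a' => X k (p.1, a) (q.1, a') := by
    ext a a'
    simp [Matrix.sum_apply]
  rw [Matrix.sum_apply]
  simp only [idTensor, Matrix.of_apply]
  rw [h, map_sum, Matrix.sum_apply]

lemma idTensor_randomizing {N : Matrix A A ℂ →ₗ[ℂ] Matrix B B ℂ} (hN : IsChannel N)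
    (X : Matrix (R × A) (R × A) ℂ) :
    idTensor R (randomizing A B) X =
      (Fintype.card B : ℝ)⁻¹ • (traceSnd R B (idTensor R N X) ⊗ₖ (1 : Matrix B B ℂ)) := by
  rw [traceSnd_idTensor hN]
  ext p q
  simp [idTensor, randomizing, traceSnd, Matrix.trace, kroneckerMap_apply]
  ring

lemma relEntropy_idTensor {N : Matrix A A ℂ →ₗ[ℂ] Matrix B B ℂ} (hN : IsChannel N) {n : ℕ}
    {ρ : Matrix (Fin n × A) (Fin n × A) ℂ} (hρ : IsState ρ) :
    relEntropy (idTensor (Fin n) N ρ) (idTensor (Fin n) (randomizing A B) ρ) =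
      (Real.logb 2 (Fintype.card B) : EReal) -
        (condEntropyGivenFst (idTensor (Fin n) N ρ) : EReal) := by
  rw [idTensor_randomizing hN, relEntropy_smul_kronecker (isState_idTensor hN hρ),
    EReal.coe_sub]

lemma coe_sub_coe_sub (x : ℝ) (y : EReal) : (x : EReal) - ((x : EReal) - y) = y := by
  induction y with
  | bot => simp
  | top => simp
  | coe y => rw [← EReal.coe_sub, ← EReal.coe_sub, sub_sub_cancel]

lemma channelEntropy_eq_cbEntropy {N : Matrix A A ℂ →ₗ[ℂ] Matrix B B ℂ} (hN : IsChannel N) :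
    channelEntropy N = cbEntropy N := by
  refine le_antisymm (le_iInf₂ fun n ρ => ?_) ?_
  · rw [← coe_sub_coe_sub (Real.logb 2 (Fintype.card B)) (condEntropyGivenFst _ : EReal),
      ← relEntropy_idTensor hN ρ.2]
    exact EReal.sub_le_sub le_rfl (le_iSup₂ (f := fun (n : ℕ)
      (ρ : {ρ : Matrix (Fin n × A) (Fin n × A) ℂ // IsState ρ}) =>
      relEntropy (idTensor (Fin n) N ρ.1) (idTensor (Fin n) (randomizing A B) ρ.1)) n ρ)
  · rw [← coe_sub_coe_sub (Real.logb 2 (Fintype.card B)) (cbEntropy N)]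
    refine EReal.sub_le_sub le_rfl ?_
    unfold channelRelEntropy
    refine iSup₂_le fun n ρ => ?_
    rw [relEntropy_idTensor hN ρ.2]
    refine EReal.sub_le_sub le_rfl ?_
    exact iInf₂_le (f := fun (n : ℕ)
      (ρ : {ρ : Matrix (Fin n × A) (Fin n × A) ℂ // IsState ρ}) =>
      ((condEntropyGivenFst (idTensor (Fin n) N ρ.1) : ℝ) : EReal)) n ρ

/-- **Stinespring dilation**: every channel has an isometric extension. -/
lemma exists_isIsometricExtension {N : Matrix A A ℂ →ₗ[ℂ] Matrix B B ℂ} (hN : IsChannel N) :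
    ∃ V : Matrix (B × (Fin (Fintype.card A) × B)) A ℂ, IsIsometricExtension N V := by
  let e := (Fintype.equivFin A).symm
  -- The unnormalized maximally entangled vector: its image under `id ⊗ N` is the Choi matrix,
  -- factored below as `Mᴴ M`.
  let φ : Fin (Fintype.card A) × A → ℂ := fun p => if e p.1 = p.2 then 1 else 0
  obtain ⟨M, hM⟩ := exists_eq_conjTranspose_mul
    (hN.completely_positive _ _ (posSemidef_vecMulVec_self_star φ))
  have hφ (a a' : A) (b b' : B) : N (Matrix.single a a' 1) b b' =
      ∑ k, star (M k (e.symm a, b)) * M k (e.symm a', b') := by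
    have h := congrFun (congrFun hM (e.symm a, b)) (e.symm a', b')
    rw [Matrix.mul_apply] at h
    refine Eq.trans ?_ h
    have hx : Matrix.single a a' (1 : ℂ) = Matrix.of fun x y =>
        vecMulVec φ (star φ) (e.symm a, x) (e.symm a', y) := by
      ext x y
      simp only [φ, vecMulVec_apply, Matrix.single_apply, ite_and, Equiv.apply_symm_apply,
        Matrix.of_apply, Pi.star_apply]
      split_ifs <;> simp
    rw [hx]
    rfl
  -- Each conjugated row of `M` is a Kraus operator, and `V` stacks them, the row index serving as
  -- environment.
  let V : Matrix (B × (Fin (Fintype.card A) × B)) A ℂ :=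
    Matrix.of fun p a => star (M p.2 (e.symm a, p.1))
  refine ⟨V, ?_, ?_⟩
  · ext a a'
    have h := hN.trace_preserving (Matrix.single a' a 1)
    rw [Matrix.mul_apply, Fintype.sum_prod_type]
    simp only [Matrix.trace, diag_apply, hφ] at h
    simp only [conjTranspose_apply, V, Matrix.of_apply, star_star]
    simp only [mul_comm (M _ _)]
    rw [h]
    simp [Matrix.single_apply, Matrix.one_apply, ite_and]
  · refine Matrix.ext_linearMap ℂ fun a a' => LinearMap.ext_ring ?_
    ext b b'
    simp only [LinearMap.comp_apply, singleLinearMap_apply, hφ, traceSnd, conjMap,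
      LinearMap.coe_mk, AddHom.coe_mk, Matrix.of_apply]
    refine Finset.sum_congr rfl fun k _ => ?_
    rw [Matrix.mul_apply, Finset.sum_eq_single a']
    · rw [Matrix.mul_apply, Finset.sum_eq_single a]
      · simp [V]
      · intro x _ hx
        simp [hx.symm]
      · simp
    · intro x _ hx
      rw [Matrix.mul_apply, Finset.sum_eq_zero, zero_mul]
      intro y _
      simp [hx.symm]
    · simp

/-! ### Pure inputs, complementary channels and the entropy gain -/

section Extension

variable {N : Matrix A A ℂ →ₗ[ℂ] Matrix B B ℂ} {V : Matrix (B × E) A ℂ}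

lemma traceSnd_vecMulVec (ψ : R × A → ℂ) : traceSnd R A (vecMulVec ψ (star ψ)) =
    (Matrix.of fun r a => ψ (r, a)) * (Matrix.of fun r a => ψ (r, a))ᴴ := by
  ext r r'
  simp [traceSnd, vecMulVec_apply, Matrix.mul_apply]

lemma traceFst_vecMulVec (ψ : R × A → ℂ) : traceFst R A (vecMulVec ψ (star ψ)) =
    ((Matrix.of fun r a => ψ (r, a))ᴴ * (Matrix.of fun r a => ψ (r, a)))ᵀ := by
  ext r r'
  simp [traceFst, vecMulVec_apply, Matrix.mul_apply, mul_comm]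

lemma entropy_traceSnd_vecMulVec (ψ : R × A → ℂ) :
    entropy (traceSnd R A (vecMulVec ψ (star ψ))) =
      entropy (traceFst R A (vecMulVec ψ (star ψ))) := by
  rw [traceSnd_vecMulVec, traceFst_vecMulVec, entropy_mul_conjTranspose,
    entropy_transpose (isHermitian_conjTranspose_mul_self _)]

/-- Let `K` be the matrix of the vector `(1 ⊗ V)ψ` for the cut `RB|E`. The two marginals are `K Kᴴ`
and `(Kᴴ K)ᵀ`. -/
lemma entropy_idTensor_vecMulVec (hV : IsIsometricExtension N V) (ψ : R × A → ℂ) :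
    entropy (idTensor R N (vecMulVec ψ (star ψ))) =
      entropy (complementary V (traceFst R A (vecMulVec ψ (star ψ)))) := by
  let K : Matrix (R × B) E ℂ := Matrix.of fun p e => ∑ a, V (p.2, e) a * ψ (p.1, a)
  have h1 : idTensor R N (vecMulVec ψ (star ψ)) = K * Kᴴ := by
    ext p q
    simp only [hV.extends_channel, idTensor, Matrix.of_apply, LinearMap.comp_apply, traceSnd,
      conjMap, LinearMap.coe_mk, AddHom.coe_mk, Matrix.mul_apply, conjTranspose_apply, K,
      vecMulVec_apply, star_sum, star_mul', Pi.star_apply, Finset.sum_mul, Finset.mul_sum]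
    refine Finset.sum_congr rfl fun e _ => Finset.sum_congr rfl fun a _ =>
      Finset.sum_congr rfl fun a' _ => ?_
    ring
  have h2 : complementary V (traceFst R A (vecMulVec ψ (star ψ))) = (Kᴴ * K)ᵀ := by
    ext e e'
    simp only [complementary, LinearMap.comp_apply, traceFst,
      conjMap, LinearMap.coe_mk, AddHom.coe_mk, Matrix.mul_apply, conjTranspose_apply, K,
      Matrix.of_apply, transpose_apply, Fintype.sum_prod_type,
      vecMulVec_apply, star_sum, star_mul', Pi.star_apply, Finset.sum_mul, Finset.mul_sum]
    rw [Finset.sum_comm (s := (Finset.univ : Finset R))]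
    refine Finset.sum_congr rfl fun b _ => ?_
    rw [Finset.sum_comm, Finset.sum_comm (s := (Finset.univ : Finset R))]
    refine Finset.sum_congr rfl fun a _ => ?_
    rw [Finset.sum_comm (s := (Finset.univ : Finset R))]
    refine Finset.sum_congr rfl fun a' _ => Finset.sum_congr rfl fun r _ => ?_
    ring
  rw [h1, h2, entropy_mul_conjTranspose, entropy_transpose (isHermitian_conjTranspose_mul_self _)]

lemma condEntropyGivenFst_idTensor_vecMulVec (hN : IsChannel N) (hV : IsIsometricExtension N V)
    (ψ : R × A → ℂ) :
    condEntropyGivenFst (idTensor R N (vecMulVec ψ (star ψ))) =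
      entropy (complementary V (traceFst R A (vecMulVec ψ (star ψ)))) -
        entropy (traceFst R A (vecMulVec ψ (star ψ))) := by
  rw [condEntropyGivenFst, traceSnd_idTensor hN, entropy_idTensor_vecMulVec hV,
    entropy_traceSnd_vecMulVec]

lemma exists_purification (e : R ≃ A) {ρ : Matrix A A ℂ} (hρ : IsState ρ) :
    ∃ ψ : R × A → ℂ, IsPureState (vecMulVec ψ (star ψ)) ∧
      traceFst R A (vecMulVec ψ (star ψ)) = ρ := by
  obtain ⟨M, hM⟩ := exists_eq_conjTranspose_mul hρ.1
  let ψ : R × A → ℂ := fun p => star (M (e p.1) p.2)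
  have h : traceFst R A (vecMulVec ψ (star ψ)) = ρ := by
    ext a a'
    rw [hM, Matrix.mul_apply, ← e.sum_comp]
    simp [traceFst, vecMulVec_apply, ψ]
  refine ⟨ψ, ⟨⟨posSemidef_vecMulVec_self_star ψ, ?_⟩, ψ, rfl⟩, h⟩
  rw [← trace_traceFst, h, hρ.2]

lemma isState_traceFst {ρ : Matrix (R × A) (R × A) ℂ} (hρ : IsState ρ) :
    IsState (traceFst R A ρ) :=
  ⟨traceFst_posSemidef hρ.1, by rw [trace_traceFst, hρ.2]⟩

lemma cbEntropyPure_eq_entropyGain (hN : IsChannel N) (hV : IsIsometricExtension N V) :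
    cbEntropyPure N = entropyGain (complementary V) := by
  refine le_antisymm (le_iInf fun ρ => ?_) (le_iInf fun ψ => ?_)
  · obtain ⟨ψ, hψ, h⟩ := exists_purification (Equiv.refl A) ρ.2
    rw [← h, ← condEntropyGivenFst_idTensor_vecMulVec hN hV]
    exact iInf_le (fun ψ : {ψ : Matrix (A × A) (A × A) ℂ // IsPureState ψ} =>
      ((condEntropyGivenFst (idTensor A N ψ.1) : ℝ) : EReal)) ⟨_, hψ⟩
  · obtain ⟨ψ, hs, φ, rfl⟩ := ψ
    rw [condEntropyGivenFst_idTensor_vecMulVec hN hV]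
    exact iInf_le (fun ρ : {ρ : Matrix A A ℂ // IsState ρ} =>
      ((entropy (complementary V ρ.1) - entropy ρ.1 : ℝ) : EReal)) ⟨_, isState_traceFst hs⟩

lemma conjMap_posSemidef {ρ : Matrix A A ℂ} (hρ : ρ.PosSemidef) :
    (conjMap V ρ).PosSemidef :=
  hρ.mul_mul_conjTranspose_same V

lemma trace_conjMap (hV : IsIsometricExtension N V) (ρ : Matrix A A ℂ) :
    (conjMap V ρ).trace = ρ.trace := by
  change (V * ρ * Vᴴ).trace = _
  rw [Matrix.mul_assoc, trace_mul_comm, Matrix.mul_assoc, hV.isometry, Matrix.mul_one]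

lemma isState_conjMap (hV : IsIsometricExtension N V) {ρ : Matrix A A ℂ} (hρ : IsState ρ) :
    IsState (conjMap V ρ) :=
  ⟨conjMap_posSemidef hρ.1, (trace_conjMap hV ρ).trans hρ.2⟩

lemma entropy_conjMap (hV : IsIsometricExtension N V) {ρ : Matrix A A ℂ} (hρ : ρ.PosSemidef) :
    entropy (conjMap V ρ) = entropy ρ := by
  obtain ⟨M, rfl⟩ := exists_eq_conjTranspose_mul hρ
  have h : conjMap V (Mᴴ * M) = (M * Vᴴ)ᴴ * (M * Vᴴ) := by
    rw [conjTranspose_mul, conjTranspose_conjTranspose]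
    simp only [conjMap, LinearMap.coe_mk, AddHom.coe_mk, Matrix.mul_assoc]
  have h2 : (M * Vᴴ) * (M * Vᴴ)ᴴ = M * Mᴴ := by
    rw [conjTranspose_mul, conjTranspose_conjTranspose, Matrix.mul_assoc, ← Matrix.mul_assoc Vᴴ,
      hV.isometry, Matrix.one_mul]
  rw [h, ← entropy_mul_conjTranspose, h2, entropy_mul_conjTranspose]

lemma condEntropyGivenSnd_conjMap (hV : IsIsometricExtension N V) {ρ : Matrix A A ℂ}
    (hρ : ρ.PosSemidef) :
    condEntropyGivenSnd (conjMap V ρ) = -(entropy (complementary V ρ) - entropy ρ) := by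
  rw [condEntropyGivenSnd, entropy_conjMap hV hρ, neg_sub]
  rfl

lemma neg_maxEnvCondEntropy (hV : IsIsometricExtension N V) :
    -maxEnvCondEntropy V = entropyGain (complementary V) := by
  refine le_antisymm (le_iInf fun ρ => ?_) ?_
  · rw [EReal.neg_le, ← EReal.coe_neg, ← condEntropyGivenSnd_conjMap hV ρ.2.1]
    exact le_iSup (fun ρ : {ρ : Matrix A A ℂ // IsState ρ} =>
      ((condEntropyGivenSnd (conjMap V ρ.1) : ℝ) : EReal)) ρ
  · rw [EReal.le_neg]
    refine iSup_le fun ρ => ?_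
    rw [condEntropyGivenSnd_conjMap hV ρ.2.1, EReal.coe_neg, EReal.neg_le_neg_iff]
    exact iInf_le (fun ρ : {ρ : Matrix A A ℂ // IsState ρ} =>
      ((entropy (complementary V ρ.1) - entropy ρ.1 : ℝ) : EReal)) ρ

/-! ### Reduction of mixed inputs to pure inputs -/

lemma eq_sum_vecMulVec (M : Matrix C A ℂ) :
    Mᴴ * M = ∑ k, vecMulVec (star (M k)) (star (star (M k))) := by
  ext x y
  simp [Matrix.mul_apply, Matrix.sum_apply, vecMulVec_apply]

/-- Rescaling a matrix shifts its entropy by a term depending only on the trace. Input and output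
traces agree, so the entropy difference is homogeneous of degree one. -/
lemma lt_entropy_complementary_sub (hV : IsIsometricExtension N V) {m : ℝ}
    (hm : ∀ ρ, IsState ρ → m < entropy (complementary V ρ) - entropy ρ) {ρ : Matrix A A ℂ}
    (hρ : ρ.PosSemidef) (h0 : 0 < ρ.trace.re) :
    ρ.trace.re * m < entropy (complementary V ρ) - entropy ρ := by
  have ht : ρ.trace = (ρ.trace.re : ℂ) :=
    Complex.ext rfl (Complex.nonneg_iff.mp hρ.trace_nonneg).2.symm
  set c := ρ.trace.re with hc
  have hs : IsState (c⁻¹ • ρ) := by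
    refine ⟨hρ.smul (by positivity), ?_⟩
    rw [trace_smul, ht, ← Complex.coe_smul, smul_eq_mul, ← Complex.ofReal_mul,
      inv_mul_cancel₀ h0.ne', Complex.ofReal_one]
  have hcomp : (complementary V ρ).PosSemidef := traceFst_posSemidef (conjMap_posSemidef hρ)
  have htr : (complementary V ρ).trace = ρ.trace :=
    (trace_traceFst _).trans (trace_conjMap hV ρ)
  have hlin : complementary V (c⁻¹ • ρ) = c⁻¹ • complementary V ρ :=
    (complementary V).map_smul_of_tower c⁻¹ ρ
  have h := hm _ hs
  rw [hlin, entropy_smul hρ.1 (inv_ne_zero h0.ne'), entropy_smul hcomp.1 (inv_ne_zero h0.ne'),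
    htr, sub_sub_sub_cancel_right, ← mul_sub, inv_mul_eq_div, lt_div_iff₀ h0] at h
  rwa [mul_comm]

/-- If every state had gain above `m`, decomposing `ρ` into unnormalized pure parts and using
concavity would force `m` to exceed itself. Arguing by contradiction makes minimizers unnecessary.
-/
lemma exists_entropyGain_le (hN : IsChannel N) (hV : IsIsometricExtension N V) {n : ℕ}
    {ρ : Matrix (Fin n × A) (Fin n × A) ℂ} (hρ : IsState ρ) :
    ∃ σ, IsState σ ∧ entropy (complementary V σ) - entropy σ ≤
      condEntropyGivenFst (idTensor (Fin n) N ρ) := by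
  by_contra! hm
  obtain ⟨M, hM⟩ := exists_eq_conjTranspose_mul hρ.1
  have hsum := eq_sum_vecMulVec M
  rw [← hM] at hsum
  set m := condEntropyGivenFst (idTensor (Fin n) N ρ) with hmdef
  let X := fun k => vecMulVec (star (M k)) (star (star (M k)))
  have hX (k) : (X k).PosSemidef := posSemidef_vecMulVec_self_star _
  have h1 : ∑ k, condEntropyGivenFst (idTensor (Fin n) N (X k)) ≤ m := by
    rw [hmdef, hsum, idTensor_sum]
    exact sum_condEntropyGivenFst_le fun k => hN.completely_positive _ _ (hX k)
  have h2 : ∑ k, (X k).trace.re = 1 := by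
    rw [← Complex.re_sum, ← trace_sum, ← hsum, hρ.2, Complex.one_re]
  have h3 (k) (hk : 0 < (X k).trace.re) :
      (X k).trace.re * m < condEntropyGivenFst (idTensor (Fin n) N (X k)) := by
    rw [condEntropyGivenFst_idTensor_vecMulVec hN hV, ← trace_traceFst]
    refine lt_entropy_complementary_sub hV hm (traceFst_posSemidef (hX k)) ?_
    rwa [trace_traceFst]
  have h4 (k) : (X k).trace.re * m ≤ condEntropyGivenFst (idTensor (Fin n) N (X k)) := by
    have h5 := (Complex.nonneg_iff.mp (hX k).trace_nonneg)
    rcases h5.1.eq_or_lt with hk | hk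
    · have h6 : X k = 0 := (hX k).trace_eq_zero_iff.mp (Complex.ext hk.symm h5.2.symm)
      have h7 : idTensor (Fin n) N (X k) = 0 := by
        rw [h6]
        simpa using idTensor_sum (R := Fin n) (∅ : Finset ℕ) N (fun _ => 0)
      rw [← hk, h7, condEntropyGivenFst, map_zero, entropy_zero, entropy_zero]
      simp
    · exact (h3 k hk).le
  -- The traces sum to one, so some part has positive trace and makes the summed inequality strict.
  obtain ⟨k, -, hk⟩ := Finset.exists_lt_of_sum_lt (s := Finset.univ) (f := fun _ => (0 : ℝ))
    (g := fun k => (X k).trace.re) (by rw [h2]; simp)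
  have h8 := Finset.sum_lt_sum (fun k _ => h4 k) ⟨k, Finset.mem_univ _, h3 k hk⟩
  rw [← Finset.sum_mul, h2, one_mul] at h8
  exact absurd h1 (not_le.mpr h8)

lemma cbEntropy_eq_entropyGain (hN : IsChannel N) (hV : IsIsometricExtension N V) :
    cbEntropy N = entropyGain (complementary V) := by
  refine le_antisymm (le_iInf fun ρ => ?_) (le_iInf₂ fun n ρ => ?_)
  · obtain ⟨ψ, hψ, h⟩ := exists_purification (Fintype.equivFin A).symm ρ.2
    rw [← h, ← condEntropyGivenFst_idTensor_vecMulVec hN hV]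
    exact iInf₂_le (f := fun (n : ℕ) (ρ : {ρ : Matrix (Fin n × A) (Fin n × A) ℂ // IsState ρ}) =>
      ((condEntropyGivenFst (idTensor (Fin n) N ρ.1) : ℝ) : EReal)) _ ⟨_, hψ.1⟩
  · obtain ⟨σ, hσ, h⟩ := exists_entropyGain_le hN hV ρ.2
    exact (iInf_le (fun ρ : {ρ : Matrix A A ℂ // IsState ρ} =>
      ((entropy (complementary V ρ.1) - entropy ρ.1 : ℝ) : EReal)) ⟨σ, hσ⟩).trans
      (EReal.coe_le_coe_iff.mpr h)

/-! ### Finiteness and the dimension bound -/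

lemma entropy_complementary_sub_le (hN : IsChannel N) (hV : IsIsometricExtension N V)
    {ρ : Matrix A A ℂ} (hρ : IsState ρ) :
    entropy (complementary V ρ) - entropy ρ ≤ Real.logb 2 (Fintype.card B) := by
  obtain ⟨ψ, hψ, h⟩ := exists_purification (Fintype.equivFin A).symm hρ
  rw [← h, ← condEntropyGivenFst_idTensor_vecMulVec hN hV]
  exact condEntropyGivenFst_le (isState_idTensor hN hψ.1)

lemma neg_logb_card_le (hV : IsIsometricExtension N V) {ρ : Matrix A A ℂ} (hρ : IsState ρ) :
    -Real.logb 2 (Fintype.card B) ≤ entropy (complementary V ρ) - entropy ρ := by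
  rw [neg_le, ← condEntropyGivenSnd_conjMap hV hρ.1]
  exact condEntropyGivenSnd_le (isState_conjMap hV hρ)

lemma isState_single (a : A) : IsState (Matrix.single a a (1 : ℂ)) := by
  refine ⟨?_, by simp⟩
  rw [← diagonal_single, posSemidef_diagonal_iff]
  intro i
  rw [Pi.single_apply]
  split_ifs <;> simp

/-- The lower bound holds for each state, but the upper one needs some state to exist: over an empty
`A` the infimum would be `⊤`. -/
lemma exists_entropyGain_eq_coe [Nonempty A] (hN : IsChannel N)
    (hV : IsIsometricExtension N V) :
    ∃ h : ℝ, entropyGain (complementary V) = (h : EReal) ∧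
      |h| ≤ Real.logb 2 (Fintype.card B) := by
  have h1 : ((-Real.logb 2 (Fintype.card B) : ℝ) : EReal) ≤ entropyGain (complementary V) :=
    le_iInf fun ρ => EReal.coe_le_coe_iff.mpr (neg_logb_card_le hV ρ.2)
  have h2 : entropyGain (complementary V) ≤ ((Real.logb 2 (Fintype.card B) : ℝ) : EReal) :=
    (iInf_le _ ⟨_, isState_single (Classical.arbitrary A)⟩).trans
      (EReal.coe_le_coe_iff.mpr (entropy_complementary_sub_le hN hV (isState_single _)))
  lift entropyGain (complementary V) to ℝ using
    ⟨(h2.trans_lt (EReal.coe_lt_top _)).ne, ((EReal.bot_lt_coe _).trans_le h1).ne'⟩ with h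
  exact ⟨h, rfl, abs_le.mpr ⟨EReal.coe_le_coe_iff.mp h1, EReal.coe_le_coe_iff.mp h2⟩⟩

end Extension

end QChannel
end

theorem mainTheorem3 {A B : Type*} [Fintype A] [DecidableEq A] [Nonempty A]
    [Fintype B] [DecidableEq B]
    (N : Matrix A A ℂ →ₗ[ℂ] Matrix B B ℂ) (hN : QChannel.IsChannel N) :
    QChannel.channelEntropy N = QChannel.cbEntropy N ∧
    QChannel.channelEntropy N = QChannel.cbEntropyPure N ∧
    (∀ (E : Type*) [Fintype E] [DecidableEq E] (V : Matrix (B × E) A ℂ),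
      QChannel.IsIsometricExtension N V →
        QChannel.channelEntropy N = QChannel.entropyGain (QChannel.complementary V) ∧
        QChannel.channelEntropy N = -QChannel.maxEnvCondEntropy V) ∧
    ∃ h : ℝ, QChannel.channelEntropy N = (h : EReal) ∧
      |h| ≤ Real.logb 2 (Fintype.card B) := by
  -- The pure-state formula and the bound mention no extension, yet both are proved through the
  -- entropy gain of one.
  obtain ⟨W, hW⟩ := QChannel.exists_isIsometricExtension hN
  rw [QChannel.channelEntropy_eq_cbEntropy hN]
  refine ⟨rfl, ?_, fun E _ _ V hV => ⟨QChannel.cbEntropy_eq_entropyGain hN hV, ?_⟩, ?_⟩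
  · rw [QChannel.cbEntropy_eq_entropyGain hN hW, QChannel.cbEntropyPure_eq_entropyGain hN hW]
  · rw [QChannel.cbEntropy_eq_entropyGain hN hV, QChannel.neg_maxEnvCondEntropy hV]
  · rw [QChannel.cbEntropy_eq_entropyGain hN hW]
    exact QChannel.exists_entropyGain_eq_coe hN hW
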